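/- Let $\Phi_a\subset\mathbb R^2$ be a homogeneous Poisson point process of density $\lambda_a>0$, let $o$ be the origin, let $x^*$ be the (almost surely unique) point of $\Phi_a$ closest to $o$, and let $\mathcal V^*=\{y\in\mathbb R^2:|y-x^*|<|y-z|\text{ for all }z\in\Phi_a\setminus\{x^*\}\}$ be its Voronoi cell. Let $p_c(x\mid x^*)=\mathbb P(x\in\mathcal V^*\mid x^*)$, $x\in\mathbb R^2$, where for a fixed value $x^*=y$ the conditional probability is $p_c(x\mid y)=\lim_{\varepsilon\downarrow0}\mathbb P\big(x\in\mathcal V^*\,\big|\,|x^*-y|<\varepsilon\big)$. This limit exists for all $x,y\in\mathbb R^2$, and for each $x$ the random variable $p_c(x\mid x^*)$ is a version of the conditional probability of $\{x\in\mathcal V^*\}$ given the random variable $x^*$. Let $\mathcal B(x,R)$ be the open ball of centre $x$ and radius $R$, $|\cdot|$ the Euclidean norm, absolute value or area, and let $\angle x\in[-\pi,\pi)$ be the polar angle of $x$ after the rotation about $o$ that makes $\angle x^*=0$ (no rotation if $x^*=o$; $\angle o=0$). For all $x,x^*\in\mathbb R^2$, $$p_c(x\mid x^*)=\begin{cases}1,&|x|\le|x^*|\text{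 and }\angle x=0\ \text{(i.e. $x$ lies on the segment from $o$ to $x^*$)},\\ e^{-\lambda_a|\mathcal A|}<1,&\text{otherwise,}\end{cases}\qquad \mathcal A=\mathcal B(x,|x-x^*|)\setminus\mathcal B(o,|x^*|).$$ For all $x\ne x^*$, $$|\mathcal A|=\begin{cases}r_*^2(|\angle x|+\theta_*)-|x^*|^2|\angle x|+|x||x^*|\sin(|\angle x|),&x^*\ne o,\\ \pi|x|^2,&x^*=o,\end{cases}$$ where $r_*=|x-x^*|=\sqrt{|x|^2+|x^*|^2-2|x||x^*|\cos(\angle x)}$ and $$\theta_*=\begin{cases}\pi-\arcsin\left(\frac{|x|\sin(|\angle x|)}{r_*}\right),&|x|\cos(\angle x)>|x^*|,\\ \arcsin\left(\frac{|x|\sin(|\angle x|)}{r_*}\right),&|x|\cos(\angle x)\le|x^*|.\end{cases}$$ -/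

import Mathlib

open MeasureTheory ProbabilityTheory Filter Topology

/-- The Euclidean plane. -/
abbrev Plane : Type := EuclideanSpace ℝ (Fin 2)

/-- The homogeneous Poisson point process of density `lam` on the plane, as a random set of points:
every realization is locally finite, the number of points in each bounded Borel set is a random
variable with the Poisson law of mean `lam * area`, and the numbers of points in disjoint bounded
Borel sets are independent. -/
structure IsHomogeneousPPP {Ω : Type*} [MeasurableSpace Ω] (P : Measure Ω) (lam : ℝ)
    (Φ : Ω → Set Plane) : Prop where
  locallyFinite : ∀ ω, ∀ B : Set Plane, Bornology.IsBounded B → (Φ ω ∩ B).Finite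
  measurable_count : ∀ B : Set Plane, MeasurableSet B → Bornology.IsBounded B →
    Measurable fun ω => (Φ ω ∩ B).ncard
  count_law : ∀ B : Set Plane, MeasurableSet B → Bornology.IsBounded B →
    P.map (fun ω => (Φ ω ∩ B).ncard) = poissonMeasure (lam * volume.real B).toNNReal
  count_indep : ∀ (n : ℕ) (B : Fin n → Set Plane), (∀ i, MeasurableSet (B i)) →
    (∀ i, Bornology.IsBounded (B i)) → (∀ i j, i ≠ j → Disjoint (B i) (B j)) →
    iIndepFun (fun i ω => (Φ ω ∩ B i).ncard) P

open Classical in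
/-- The point of `S` closest to the origin. If there is no unique closest point (for a Poisson
process this is an event of probability zero), the value is the origin by convention. -/
noncomputable def nearestPoint (S : Set Plane) : Plane :=
  if h : ∃ y ∈ S, ∀ z ∈ S, z ≠ y → ‖y‖ < ‖z‖ then h.choose else 0

/-- The Voronoi cell of `c` generated by the points of `S`. -/
def voronoiCell (S : Set Plane) (c : Plane) : Set Plane :=
  {y | ∀ z ∈ S \ {c}, ‖y - c‖ < ‖y - z‖}

/-- The event that `x` lies in the Voronoi cell of the point of `Φ` closest to the origin. -/
def cellEvent {Ω : Type*} (Φ : Ω → Set Plane) (x : Plane) : Set Ω :=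
  {ω | x ∈ voronoiCell (Φ ω) (nearestPoint (Φ ω))}

/-- The elementary conditional probability that `x` lies in the Voronoi cell of the point of `Φ`
closest to the origin, given that this closest point is within distance `ε` of `xs`. -/
noncomputable def cellProbNear {Ω : Type*} [MeasurableSpace Ω] (P : Measure Ω)
    (Φ : Ω → Set Plane) (x xs : Plane) (ε : ℝ) : ℝ :=
  (cond P {ω | nearestPoint (Φ ω) ∈ Metric.ball xs ε}).real (cellEvent Φ x)

/-- The probabilistic cell area function `p_c (x | xs)`: the conditional probability that `x` lies
in the Voronoi cell of the point of `Φ` closest to the origin, given that this closest point is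
`xs`. As the latter event has probability zero, the value at each single `xs` is the limit of the
elementary conditional probabilities. -/
noncomputable def pca {Ω : Type*} [MeasurableSpace Ω] (P : Measure Ω)
    (Φ : Ω → Set Plane) (x xs : Plane) : ℝ :=
  limUnder (𝓝[>] (0 : ℝ)) (cellProbNear P Φ x xs)

/-- The region `B(x, |x - xs|) \ B(o, |xs|)` (open balls). -/
def regionA (x xs : Plane) : Set Plane :=
  Metric.ball x ‖x - xs‖ \ Metric.ball 0 ‖xs‖

/-- A point of the plane as a complex number. -/
def toComplex (x : Plane) : ℂ := ⟨x 0, x 1⟩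

open Classical in
/-- The principal angular coordinate with values in `[-π, π)` (and `0` at the origin). -/
noncomputable def principalAngle (z : ℂ) : ℝ :=
  if z.arg = Real.pi then -Real.pi else z.arg

/-- The angular coordinate of `x` in `[-π, π)`, after the rotation of the plane about the origin
that moves `xs` to the nonnegative first axis (no rotation if `xs` is the origin). -/
noncomputable def angleFrom (xs x : Plane) : ℝ :=
  principalAngle (Complex.exp (-((toComplex xs).arg : ℂ) * Complex.I) * toComplex x)

open Classical in
/-- The angle `θ_*`. -/
noncomputable def thetaStar (x xs : Plane) : ℝ :=
  if ‖xs‖ < ‖x‖ * Real.cos (angleFrom xs x) then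
    Real.pi - Real.arcsin (‖x‖ * Real.sin |angleFrom xs x| / ‖x - xs‖)
  else Real.arcsin (‖x‖ * Real.sin |angleFrom xs x| / ‖x - xs‖)

/-! Almost surely, `x` lies in the cell of the point nearest to the origin exactly when one point
`c` of the process is nearest to both the origin and `x`, that is, when no other point lies in the
union of the balls about these centres through `c` (`forbiddenRegion x c`). For a small ball `Q`
around `y`, having such a `c` in `Q` amounts, up to lower order, to one point in `Q` and none in
`forbiddenRegion x y`. Poisson counts bound this probability above and below by terms of order `lam
* exp (-lam * |forbiddenRegion x y|) * |Q|`, and differentiation of measures turns the bounds into a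
density in `y` (`map_nearestPoint_restrict_eq_withDensity`). For `x = 0` the density has total mass
one, a Gaussian integral, so the nearest point exists almost surely and this is its law. The density
for `x` divided by that for `0` is `exp (-lam * |regionA x y|)`. This ratio is continuous in `y`, so
its averages over shrinking balls converge to it; it is also the conditional expectation. The area
is computed in polar coordinates centred at `xs`, which lies on both circles: each ray then meets
the region in a single interval with cosine endpoints (`volume_real_ball_sdiff_ball`). The angles
come from the triangle with vertices `0`, `x`, `xs`, where `thetaStar` is the angle at `xs`. -/

/-! ### Polar position of two points -/

theorem toComplex_eq_repr_symm (x : Plane) :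
    Complex.orthonormalBasisOneI.repr.symm x = toComplex x := by
  rw [LinearIsometryEquiv.symm_apply_eq]
  ext i
  rw [Complex.orthonormalBasisOneI_repr_apply]
  fin_cases i <;> rfl

theorem norm_toComplex (x : Plane) : ‖toComplex x‖ = ‖x‖ := by
  rw [← toComplex_eq_repr_symm, LinearIsometryEquiv.norm_map]

/-- The conventions `[-π, π)` and `(-π, π]` differ only in the sign at `π`, which absolute values do
not see. -/
theorem abs_principalAngle (z : ℂ) : |principalAngle z| = |z.arg| := by
  unfold principalAngle
  split_ifs with h
  · rw [h, abs_neg]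
  · rfl

theorem abs_angleFrom_le_pi (xs x : Plane) : |angleFrom xs x| ≤ Real.pi := by
  rw [angleFrom, abs_principalAngle]
  exact Complex.abs_arg_le_pi _

theorem angleFrom_eq_zero_of_cos_eq_one {xs x : Plane} (h : Real.cos (angleFrom xs x) = 1) :
    angleFrom xs x = 0 := by
  have h1 := abs_le.mp (abs_angleFrom_le_pi xs x)
  have hpi := Real.pi_pos
  exact (Real.cos_eq_one_iff_of_lt_of_lt (by linarith) (by linarith)).mp h

theorem angleFrom_zero_right (xs : Plane) : angleFrom xs 0 = 0 := by
  have : toComplex 0 = 0 := by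
    apply Complex.ext <;> simp [toComplex]
  simp [angleFrom, this, principalAngle, Real.pi_ne_zero.symm]

/-- Coordinates in which `x` lies on the nonnegative real axis and `xs` in the closed upper
half-plane. -/
theorem exists_linearIsometryEquiv_polar (x xs : Plane) :
    ∃ T : Plane ≃ₗᵢ[ℝ] ℂ, T x = (‖x‖ : ℂ) ∧
      T xs = ‖xs‖ * (Real.cos |angleFrom xs x| + Real.sin |angleFrom xs x| * Complex.I) := by
  set c : ℂ := Complex.exp (-((toComplex xs).arg : ℂ) * Complex.I) with hc
  set w : ℂ := c * toComplex x with hw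
  have hcn : ‖c‖ = 1 := by
    rw [hc, ← Complex.ofReal_neg, Complex.norm_exp_ofReal_mul_I]
  have hwn : ‖w‖ = ‖x‖ := by rw [hw, norm_mul, hcn, one_mul, norm_toComplex]
  have habs : |angleFrom xs x| = |w.arg| := by rw [angleFrom, abs_principalAngle]
  have hxs : c * toComplex xs = ‖xs‖ := by
    rw [← norm_toComplex, hc]
    nth_rewrite 2 [← Complex.norm_mul_exp_arg_mul_I (toComplex xs)]
    rw [mul_left_comm, ← Complex.exp_add]
    simp
  let T₁ : Plane ≃ₗᵢ[ℝ] ℂ := Complex.orthonormalBasisOneI.repr.symm.trans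
    (rotation (Circle.exp (-(toComplex xs).arg) * Circle.exp (-w.arg)))
  have hT₁ : ∀ z, T₁ z = Complex.exp (-(w.arg : ℂ) * Complex.I) * (c * toComplex z) := by
    intro z
    simp only [T₁, LinearIsometryEquiv.trans_apply, rotation_apply, toComplex_eq_repr_symm,
      Circle.coe_mul, Circle.coe_exp, hc]
    push_cast
    ring
  have hx : T₁ x = ‖x‖ := by
    rw [hT₁, ← hw, ← hwn]
    nth_rewrite 2 [← Complex.norm_mul_exp_arg_mul_I w]
    rw [mul_left_comm, ← Complex.exp_add]
    simp
  have hxs₁ : T₁ xs = ‖xs‖ * (Real.cos (-w.arg) + Real.sin (-w.arg) * Complex.I) := by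
    rw [hT₁, hxs, mul_comm, ← Complex.ofReal_neg, Complex.exp_mul_I]
    push_cast
    rfl
  -- With `x` on the axis, `xs` has argument `-w.arg`; if that is negative, a reflection brings it
  -- to the upper half-plane.
  rcases le_total w.arg 0 with h | h
  · refine ⟨T₁, hx, ?_⟩
    rw [hxs₁, habs, abs_of_nonpos h]
  · refine ⟨T₁.trans Complex.conjLIE, ?_, ?_⟩
    · simp [hx]
    · rw [habs, abs_of_nonneg h, LinearIsometryEquiv.trans_apply, hxs₁]
      simp [← Complex.cos_conj, ← Complex.sin_conj]

theorem norm_sub_sq_eq_of_angleFrom (x xs : Plane) :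
    ‖x - xs‖ ^ 2 =
      ‖x‖ ^ 2 + ‖xs‖ ^ 2 - 2 * ‖x‖ * ‖xs‖ * Real.cos (angleFrom xs x) := by
  obtain ⟨T, hx, hxs⟩ := exists_linearIsometryEquiv_polar x xs
  rw [← T.norm_map (x - xs), map_sub, hx, hxs, ← Real.cos_abs (angleFrom xs x),
    ← Complex.normSq_eq_norm_sq, Complex.normSq_apply]
  simp only [Complex.sub_re, Complex.sub_im, Complex.mul_re, Complex.mul_im, Complex.add_re,
    Complex.add_im, Complex.ofReal_re, Complex.ofReal_im, Complex.I_re, Complex.I_im]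
  linear_combination ‖xs‖ ^ 2 * Real.sin_sq_add_cos_sq |angleFrom xs x|

theorem norm_sub_eq_sqrt_of_angleFrom (x xs : Plane) :
    ‖x - xs‖ =
      Real.sqrt (‖x‖ ^ 2 + ‖xs‖ ^ 2 - 2 * ‖x‖ * ‖xs‖ * Real.cos (angleFrom xs x)) := by
  rw [← norm_sub_sq_eq_of_angleFrom, Real.sqrt_sq (norm_nonneg _)]

/-! ### When the region is empty and when it has positive area -/

theorem regionA_eq_empty {x xs : Plane} (h : ‖x‖ ≤ ‖xs‖) (ha : angleFrom xs x = 0) :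
    regionA x xs = ∅ := by
  have h1 := norm_sub_sq_eq_of_angleFrom x xs
  rw [ha, Real.cos_zero] at h1
  have h2 : ‖x - xs‖ = ‖xs‖ - ‖x‖ := by
    rw [← sq_eq_sq₀ (norm_nonneg _) (by linarith), h1]
    ring
  rw [regionA, Set.sdiff_eq_empty]
  apply Metric.ball_subset_ball'
  rw [dist_zero_right, h2]
  linarith

/-- Equality in the triangle inequality would force the cosine in the law of cosines to be one,
unless `x = 0`; both cases put `x` on the segment. -/
theorem norm_lt_norm_sub_add_norm {x xs : Plane} (h : ¬ (‖x‖ ≤ ‖xs‖ ∧ angleFrom xs x = 0)) :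
    ‖xs‖ < ‖x - xs‖ + ‖x‖ := by
  by_contra! hle
  have h1 := norm_sub_sq_eq_of_angleFrom x xs
  have hr := norm_nonneg (x - xs)
  have hx := norm_nonneg x
  have hle' : ‖x‖ ≤ ‖xs‖ := by linarith
  have hsq : ‖x - xs‖ ^ 2 ≤ (‖xs‖ - ‖x‖) ^ 2 := by
    apply pow_le_pow_left₀ hr; linarith
  have hprod : ‖x‖ * ‖xs‖ * (1 - Real.cos (angleFrom xs x)) ≤ 0 := by nlinarith
  apply h ⟨hle', ?_⟩
  by_cases hx0 : x = 0
  · rw [hx0, angleFrom_zero_right]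
  · apply angleFrom_eq_zero_of_cos_eq_one
    have hxp : 0 < ‖x‖ := norm_pos_iff.mpr hx0
    have hp : 0 < ‖x‖ * ‖xs‖ := mul_pos hxp (hxp.trans_le hle')
    have := Real.cos_le_one (angleFrom xs x)
    nlinarith

/-- Moving outward from `x`, away from the origin, by slightly less than the radius leaves the ball
about the origin, so the region contains a nonempty open set. -/
theorem volume_regionA_pos {x xs : Plane} (h : ¬ (‖x‖ ≤ ‖xs‖ ∧ angleFrom xs x = 0)) :
    0 < volume.real (regionA x xs) := by
  have hlt := norm_lt_norm_sub_add_norm h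
  have hne : x ≠ xs := by
    rintro rfl
    simp at hlt
  have hr : 0 < ‖x - xs‖ := norm_pos_iff.mpr (sub_ne_zero.mpr hne)
  have hsub : Metric.ball x ‖x - xs‖ \ Metric.closedBall 0 ‖xs‖ ⊆ regionA x xs :=
    Set.sdiff_subset_sdiff_right Metric.ball_subset_closedBall
  have hopen : IsOpen (Metric.ball x ‖x - xs‖ \ Metric.closedBall (0 : Plane) ‖xs‖) :=
    Metric.isOpen_ball.sdiff Metric.isClosed_closedBall
  obtain ⟨u, hu, hux⟩ : ∃ u : Plane, ‖u‖ = 1 ∧ x = ‖x‖ • u := by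
    by_cases hx0 : x = 0
    · refine ⟨EuclideanSpace.single 0 1, by simp, by simp [hx0]⟩
    · refine ⟨‖x‖⁻¹ • x, norm_smul_inv_norm hx0, ?_⟩
      rw [smul_inv_smul₀ (norm_ne_zero_iff.mpr hx0)]
  obtain ⟨t, ht0, htr, htx⟩ : ∃ t : ℝ, 0 ≤ t ∧ t < ‖x - xs‖ ∧ ‖xs‖ - ‖x‖ < t := by
    obtain ⟨t, h1, h2⟩ := exists_between (max_lt hr (show ‖xs‖ - ‖x‖ < ‖x - xs‖ by linarith))
    exact ⟨t, ((le_max_left _ _).trans_lt h1).le, h2, (le_max_right _ _).trans_lt h1⟩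
  have hmem : x + t • u ∈ Metric.ball x ‖x - xs‖ \ Metric.closedBall (0 : Plane) ‖xs‖ := by
    constructor
    · rw [mem_ball_iff_norm, add_sub_cancel_left, norm_smul, hu, mul_one, Real.norm_of_nonneg ht0]
      exact htr
    · have hsum : x + t • u = (‖x‖ + t) • u := by rw [add_smul, ← hux]
      rw [mem_closedBall_zero_iff, not_le, hsum, norm_smul, hu, mul_one, Real.norm_of_nonneg (by positivity)]
      linarith
  have hpos := hopen.measure_pos volume ⟨_, hmem⟩
  refine ENNReal.toReal_pos (hpos.trans_le (measure_mono hsub)).ne' ?_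
  exact ((measure_mono Set.sdiff_subset).trans_lt measure_ball_lt_top).ne

/-! ### Area of the difference of two discs -/

theorem volume_real_plane_ball (x : Plane) {r : ℝ} (hr : 0 ≤ r) :
    volume.real (Metric.ball x r) = Real.pi * r ^ 2 := by
  rw [measureReal_def, EuclideanSpace.volume_ball_fin_two, ENNReal.toReal_mul, ENNReal.toReal_pow,
    ENNReal.toReal_ofReal hr, ENNReal.toReal_ofReal Real.pi_pos.le, mul_comm]

theorem volume_real_regionA_zero (x : Plane) :
    volume.real (regionA x 0) = Real.pi * ‖x‖ ^ 2 := by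
  simp [regionA, volume_real_plane_ball]

theorem lintegral_Ioi_inter_Ico_ofReal {m M : ℝ} (h : max 0 m ≤ M) :
    ∫⁻ t in Set.Ioi 0 ∩ Set.Ico m M, ENNReal.ofReal t =
      ENNReal.ofReal ((M ^ 2 - max 0 m ^ 2) / 2) := by
  have hset : Set.Ioi 0 ∩ Set.Ioc m M = Set.Ioc (max 0 m) M := by
    ext t
    simp only [Set.mem_inter_iff, Set.mem_Ioi, Set.mem_Ioc, max_lt_iff, and_assoc]
  rw [Measure.restrict_congr_set ((ae_eq_refl _).inter Ico_ae_eq_Ioc), hset, ← ofReal_integral_eq_lintegral_ofReal,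
    ← intervalIntegral.integral_of_le h, integral_id]
  · exact (continuous_id.integrableOn_Icc).mono_set Set.Ioc_subset_Icc_self
  · filter_upwards [ae_restrict_mem measurableSet_Ioc] with t ht
    exact (le_max_left 0 m).trans ht.1.le

/-- The polar form of `ball ρ r \ ball 0 R`, seen from the point `R * exp (i a)`, which lies on
both circles. -/
theorem mem_ball_sdiff_ball_polar_iff {ρ R r a γ t φ : ℝ} (hr : 0 ≤ r) (hR : 0 ≤ R) (hρ : 0 ≤ ρ)
    (hγ : γ ≤ Real.pi) (hcos : r * Real.cos γ = ρ - R * Real.cos a)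
    (hsin : r * Real.sin γ = R * Real.sin a) (ht : 0 < t) (hφ : φ ∈ Set.Ioo (-Real.pi) Real.pi) :
    ((t * (Real.cos φ + Real.sin φ * Complex.I) +
      R * (Real.cos a + Real.sin a * Complex.I) : ℂ) ∈ Metric.ball (ρ : ℂ) r \ Metric.ball 0 R) ↔
    φ ∈ Set.Ioo (-(Real.pi / 2)) (Real.pi / 2 - γ) ∧
      t ∈ Set.Ico (-(2 * R * Real.cos (φ - a))) (2 * r * Real.cos (φ + γ)) := by
  -- The pole lies on both circles, so each difference of squared radius and squared distance is `t`
  -- times a linear factor in `t`; the sign of that factor decides membership.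
  have h1 : (t * (Real.cos φ + Real.sin φ * Complex.I) +
      R * (Real.cos a + Real.sin a * Complex.I) : ℂ) ∈ Metric.ball (ρ : ℂ) r ↔
      t < 2 * r * Real.cos (φ + γ) := by
    rw [mem_ball_iff_norm, ← sq_lt_sq₀ (norm_nonneg _) hr, ← Complex.normSq_eq_norm_sq,
      Complex.normSq_apply, ← sub_pos, ← sub_pos (b := t),
      ← mul_pos_iff_of_pos_left (b := 2 * r * Real.cos (φ + γ) - t) ht]
    simp only [Complex.sub_re, Complex.sub_im, Complex.mul_re, Complex.mul_im, Complex.add_re,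
      Complex.add_im, Complex.ofReal_re, Complex.ofReal_im, Complex.I_re, Complex.I_im]
    rw [Real.cos_add]
    apply iff_of_eq
    congr 1
    have e1 : R * Real.cos a = ρ - r * Real.cos γ := by linarith
    ring_nf
    linear_combination (-t ^ 2) * Real.sin_sq_add_cos_sq φ - r ^ 2 * Real.sin_sq_add_cos_sq γ
      + (R * Real.sin a + r * Real.sin γ + 2 * t * Real.sin φ) * hsin
      - (R * Real.cos a - ρ - r * Real.cos γ + 2 * t * Real.cos φ) * e1
  have h2 : (t * (Real.cos φ + Real.sin φ * Complex.I) +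
      R * (Real.cos a + Real.sin a * Complex.I) : ℂ) ∈ Metric.ball (0 : ℂ) R ↔
      t < -(2 * R * Real.cos (φ - a)) := by
    rw [mem_ball_zero_iff, ← sq_lt_sq₀ (norm_nonneg _) hR, ← Complex.normSq_eq_norm_sq,
      Complex.normSq_apply, ← sub_pos, ← sub_pos (b := t),
      ← mul_pos_iff_of_pos_left (b := -(2 * R * Real.cos (φ - a)) - t) ht]
    simp only [Complex.mul_re, Complex.mul_im, Complex.add_re,
      Complex.add_im, Complex.ofReal_re, Complex.ofReal_im, Complex.I_re, Complex.I_im]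
    rw [Real.cos_sub]
    apply iff_of_eq
    congr 1
    ring_nf
    linear_combination (-t ^ 2) * Real.sin_sq_add_cos_sq φ - R ^ 2 * Real.sin_sq_add_cos_sq a
  rw [Set.mem_sdiff, h1, h2, not_lt, Set.mem_Ico, and_comm (a := t < _)]
  refine ⟨fun h => ⟨?_, h⟩, fun h => h.2⟩
  have hpi := Real.pi_pos
  -- This is half the upper end of the interval for `t` minus half the lower end, so a nonempty
  -- interval forces `cos φ > 0`.
  have e : ρ * Real.cos φ = r * Real.cos (φ + γ) + R * Real.cos (φ - a) := by
    rw [Real.cos_add, Real.cos_sub]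
    linear_combination (-Real.cos φ) * hcos + Real.sin φ * hsin
  have hpos : 0 < Real.cos φ := by
    have : 0 < ρ * Real.cos φ := by rw [e]; linarith [h.1, h.2]
    exact pos_of_mul_pos_right this hρ
  have hpos' : 0 < Real.cos (φ + γ) := by
    have : 0 < r * Real.cos (φ + γ) := by linarith [h.2]
    exact pos_of_mul_pos_right this hr
  have hφ₁ : -(Real.pi / 2) < φ := by
    by_contra! hc
    have := Real.cos_nonpos_of_pi_div_two_le_of_le (x := -φ) (by linarith) (by linarith [hφ.1])
    rw [Real.cos_neg] at this
    linarith
  have hφ₂ : φ < Real.pi / 2 := by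
    by_contra! hc
    have := Real.cos_nonpos_of_pi_div_two_le_of_le (x := φ) (by linarith) (by linarith [hφ.2])
    linarith
  refine ⟨hφ₁, ?_⟩
  by_contra! hc
  have := Real.cos_nonpos_of_pi_div_two_le_of_le (x := φ + γ) (by linarith) (by linarith)
  linarith

/-- The ray enters the removed disc only for `φ < a - π / 2`, where `cos (φ - a)` is negative; the
integral is split there. -/
theorem integral_max_neg_cos_sq {a γ : ℝ} (ha₀ : 0 ≤ a) (hγ₀ : 0 ≤ γ) (haγ : a + γ ≤ Real.pi) :
    ∫ φ in (-(Real.pi / 2))..(Real.pi / 2 - γ), max 0 (-Real.cos (φ - a)) ^ 2 =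
      (a - Real.sin a * Real.cos a) / 2 := by
  have hpi := Real.pi_pos
  have hcont : Continuous fun φ => max 0 (-Real.cos (φ - a)) ^ 2 := by fun_prop
  rw [← intervalIntegral.integral_add_adjacent_intervals (b := a - Real.pi / 2)
    (hcont.intervalIntegrable _ _) (hcont.intervalIntegrable _ _)]
  have h1 : ∫ φ in (-(Real.pi / 2))..(a - Real.pi / 2), max 0 (-Real.cos (φ - a)) ^ 2 =
      ∫ φ in (-(Real.pi / 2))..(a - Real.pi / 2), Real.cos (φ - a) ^ 2 := by
    apply intervalIntegral.integral_congr
    intro φ hφ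
    rw [Set.uIcc_of_le (by linarith)] at hφ
    have := Real.cos_nonpos_of_pi_div_two_le_of_le (x := -(φ - a)) (by linarith [hφ.2])
      (by linarith [hφ.1])
    rw [Real.cos_neg] at this
    simp only
    rw [max_eq_right (by linarith), neg_sq]
  have h2 : ∫ φ in (a - Real.pi / 2)..(Real.pi / 2 - γ), max 0 (-Real.cos (φ - a)) ^ 2 =
      ∫ φ in (a - Real.pi / 2)..(Real.pi / 2 - γ), (0 : ℝ) := by
    apply intervalIntegral.integral_congr
    intro φ hφ
    rw [Set.uIcc_of_le (by linarith)] at hφ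
    have := Real.cos_nonneg_of_neg_pi_div_two_le_of_le (x := φ - a) (by linarith [hφ.1])
      (by linarith [hφ.2])
    simp only
    rw [max_eq_left (by linarith), zero_pow two_ne_zero]
  rw [h1, h2, intervalIntegral.integral_comp_sub_right (fun φ => Real.cos φ ^ 2), integral_cos_sq,
    show a - Real.pi / 2 - a = -(Real.pi / 2) by ring,
    show -(Real.pi / 2) - a = -(a + Real.pi / 2) by ring]
  simp only [Real.cos_neg, Real.sin_neg, Real.cos_add_pi_div_two, Real.sin_add_pi_div_two,
    Real.cos_pi_div_two, intervalIntegral.integral_zero]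
  ring

theorem volume_real_ball_sdiff_ball {ρ R r a γ : ℝ} (hr : 0 ≤ r) (hR : 0 ≤ R) (hρ : 0 ≤ ρ)
    (ha₀ : 0 ≤ a) (hγ₀ : 0 ≤ γ) (haγ : a + γ ≤ Real.pi)
    (hcos : r * Real.cos γ = ρ - R * Real.cos a) (hsin : r * Real.sin γ = R * Real.sin a) :
    volume.real (Metric.ball (ρ : ℂ) r \ Metric.ball 0 R) =
      r ^ 2 * (Real.pi - γ) - R ^ 2 * a + ρ * R * Real.sin a := by
  have hpi := Real.pi_pos
  set S : Set ℂ := Metric.ball (ρ : ℂ) r \ Metric.ball 0 R with hS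
  have hSm : MeasurableSet S := measurableSet_ball.diff measurableSet_ball
  set b : ℂ := R * (Real.cos a + Real.sin a * Complex.I) with hb
  set I : Set ℝ := Set.Ioo (-(Real.pi / 2)) (Real.pi / 2 - γ) with hI
  set m : ℝ → ℝ := fun φ => -(2 * R * Real.cos (φ - a)) with hm
  set M : ℝ → ℝ := fun φ => 2 * r * Real.cos (φ + γ) with hM
  set F : ℝ → ℝ := fun φ =>
    2 * r ^ 2 * Real.cos (φ + γ) ^ 2 - 2 * R ^ 2 * max 0 (-Real.cos (φ - a)) ^ 2 with hF
  have hmax : ∀ φ, max 0 (m φ) = 2 * R * max 0 (-Real.cos (φ - a)) := by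
    intro φ
    rw [mul_max_of_nonneg _ _ (by positivity), mul_zero, mul_neg]
  have hmM : ∀ φ ∈ I, max 0 (m φ) ≤ M φ := by
    intro φ hφ
    have h1 : 0 ≤ Real.cos (φ + γ) := Real.cos_nonneg_of_neg_pi_div_two_le_of_le
      (by linarith [hφ.1]) (by linarith [hφ.2])
    have h2 : 0 ≤ Real.cos φ := Real.cos_nonneg_of_neg_pi_div_two_le_of_le
      (by linarith [hφ.1]) (by linarith [hφ.2])
    have e : ρ * Real.cos φ = r * Real.cos (φ + γ) + R * Real.cos (φ - a) := by
      rw [Real.cos_add, Real.cos_sub]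
      linear_combination (-Real.cos φ) * hcos + Real.sin φ * hsin
    have h3 := mul_nonneg hρ h2
    apply max_le
    · simp only [hM]; positivity
    · simp only [hM, hm]; linarith
  have hFeq : ∀ φ, (M φ ^ 2 - max 0 (m φ) ^ 2) / 2 = F φ := by
    intro φ
    rw [hmax]
    simp only [hM, hF]
    ring
  have hF0 : ∀ φ ∈ I, 0 ≤ F φ := by
    intro φ hφ
    rw [← hFeq]
    have := pow_le_pow_left₀ (le_max_left _ _) (hmM φ hφ) 2
    linarith
  have hFc : Continuous F := by simp only [hF]; fun_prop
  set D : Set (ℝ × ℝ) := {p | p.2 ∈ I ∧ p.1 ∈ Set.Ioi 0 ∩ Set.Ico (m p.2) (M p.2)} with hD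
  have hDm : MeasurableSet D := by
    have hmc : Measurable fun p : ℝ × ℝ => m p.2 := by
      have : Continuous m := by simp only [hm]; fun_prop
      fun_prop
    have hMc : Measurable fun p : ℝ × ℝ => M p.2 := by
      have : Continuous M := by simp only [hM]; fun_prop
      fun_prop
    exact (measurable_snd measurableSet_Ioo).inter ((measurable_fst measurableSet_Ioi).inter
      ((measurableSet_le hmc measurable_fst).inter (measurableSet_lt measurable_fst hMc)))
  have hvol : volume S = ENNReal.ofReal (∫ φ in I, F φ) := by
    calc volume S = volume ((fun w => w + b) ⁻¹' S) := (measure_preimage_add_right _ _ _).symm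
      _ = ∫⁻ w, ((fun w => w + b) ⁻¹' S).indicator 1 w :=
        (lintegral_indicator_one (measurable_add_const b hSm)).symm
      _ = ∫⁻ p in polarCoord.target, ENNReal.ofReal p.1 •
            ((fun w => w + b) ⁻¹' S).indicator 1 (Complex.polarCoord.symm p) :=
        (Complex.lintegral_comp_polarCoord_symm _).symm
      _ = ∫⁻ p in polarCoord.target, D.indicator (fun p => ENNReal.ofReal p.1) p := by
        apply setLIntegral_congr_fun polarCoord.open_target.measurableSet
        intro p hp
        have hp' : 0 < p.1 ∧ p.2 ∈ Set.Ioo (-Real.pi) Real.pi := by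
          rw [polarCoord_target] at hp
          exact hp
        have hiff := mem_ball_sdiff_ball_polar_iff (a := a) hr hR hρ (by linarith) hcos hsin
          hp'.1 hp'.2
        have hiff' : Complex.polarCoord.symm p ∈ (fun w => w + b) ⁻¹' S ↔ p ∈ D := by
          rw [Complex.polarCoord_symm_apply]
          refine hiff.trans ⟨fun h => ⟨h.1, hp'.1, h.2⟩, fun h => ⟨h.1, h.2.2⟩⟩
        by_cases hpD : p ∈ D
        · simp only [Set.indicator_of_mem hpD, Set.indicator_of_mem (hiff'.mpr hpD),
            Pi.one_apply, smul_eq_mul, mul_one]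
        · simp only [Set.indicator_of_notMem hpD,
            Set.indicator_of_notMem (fun h => hpD (hiff'.mp h)), smul_zero]
      _ = ∫⁻ p, D.indicator (fun p => ENNReal.ofReal p.1) p := by
        rw [← lintegral_indicator polarCoord.open_target.measurableSet, Set.indicator_indicator,
          Set.inter_eq_right.mpr]
        intro p hp
        rw [polarCoord_target]
        exact ⟨hp.2.1, by linarith [hp.1.1], by linarith [hp.1.2]⟩
      _ = ∫⁻ φ, ∫⁻ t, D.indicator (fun p => ENNReal.ofReal p.1) (t, φ) := by
        rw [Measure.volume_eq_prod, lintegral_prod_symm]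
        exact ((ENNReal.measurable_ofReal.comp measurable_fst).indicator hDm).aemeasurable
      _ = ∫⁻ φ, I.indicator (fun φ => ENNReal.ofReal (F φ)) φ := by
        congr 1 with φ
        by_cases hφ : φ ∈ I
        · rw [Set.indicator_of_mem hφ, ← hFeq, ← lintegral_Ioi_inter_Ico_ofReal (hmM φ hφ),
            ← lintegral_indicator (measurableSet_Ioi.inter measurableSet_Ico)]
          congr 1 with t
          simp [Set.indicator, hD, hφ]
        · rw [Set.indicator_of_notMem hφ]
          simp [Set.indicator, hD, hφ]
      _ = ENNReal.ofReal (∫ φ in I, F φ) := by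
        rw [lintegral_indicator measurableSet_Ioo, ofReal_integral_eq_lintegral_ofReal]
        · exact hFc.integrableOn_Icc.mono_set Set.Ioo_subset_Icc_self
        · filter_upwards [ae_restrict_mem measurableSet_Ioo] with φ hφ using hF0 φ hφ
  have hint : ∫ φ in I, F φ = r ^ 2 * (Real.pi - γ) - R ^ 2 * a + ρ * R * Real.sin a := by
    rw [← integral_Ioc_eq_integral_Ioo, ← intervalIntegral.integral_of_le (by linarith)]
    simp only [hF]
    rw [intervalIntegral.integral_sub
      (Continuous.intervalIntegrable (by fun_prop) _ _)
      (Continuous.intervalIntegrable (by fun_prop) _ _),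
      intervalIntegral.integral_const_mul, intervalIntegral.integral_const_mul,
      integral_max_neg_cos_sq ha₀ hγ₀ haγ,
      intervalIntegral.integral_comp_add_right (fun φ => Real.cos φ ^ 2), integral_cos_sq,
      sub_add_cancel, show -(Real.pi / 2) + γ = γ - Real.pi / 2 by ring, Real.cos_sub_pi_div_two,
      Real.sin_sub_pi_div_two, Real.cos_pi_div_two]
    linear_combination (r * Real.cos γ) * hsin + R * Real.sin a * hcos
  rw [measureReal_def, hvol, ENNReal.toReal_ofReal
    (setIntegral_nonneg measurableSet_Ioo hF0), hint]

/-- These relations identify `thetaStar` as the angle at `xs` of the triangle `0`, `x`, `xs`. The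
sine alone leaves acute or obtuse open; the case distinction asks whether `x` projects beyond `xs`.
-/
theorem norm_mul_sin_thetaStar {x xs : Plane} (hne : x ≠ xs) :
    ‖x - xs‖ * Real.sin (thetaStar x xs) = ‖x‖ * Real.sin |angleFrom xs x| ∧
    ‖x - xs‖ * Real.cos (thetaStar x xs) = ‖xs‖ - ‖x‖ * Real.cos |angleFrom xs x| := by
  have hr : 0 < ‖x - xs‖ := norm_pos_iff.mpr (sub_ne_zero.mpr hne)
  have hlaw := norm_sub_sq_eq_of_angleFrom x xs
  rw [← Real.cos_abs (angleFrom xs x)] at hlaw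
  have ha := abs_angleFrom_le_pi xs x
  set a := |angleFrom xs x| with haa
  have hs : 0 ≤ ‖x‖ * Real.sin a :=
    mul_nonneg (norm_nonneg x) (Real.sin_nonneg_of_nonneg_of_le_pi (abs_nonneg _) ha)
  have hsq : ‖x - xs‖ ^ 2 = (‖x‖ * Real.sin a) ^ 2 + (‖xs‖ - ‖x‖ * Real.cos a) ^ 2 := by
    rw [hlaw]
    linear_combination -‖x‖ ^ 2 * Real.sin_sq_add_cos_sq a
  have hle : ‖x‖ * Real.sin a / ‖x - xs‖ ≤ 1 := by
    rw [div_le_one hr, ← sq_le_sq₀ hs hr.le, hsq]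
    nlinarith [sq_nonneg (‖xs‖ - ‖x‖ * Real.cos a)]
  have hge : 0 ≤ ‖x‖ * Real.sin a / ‖x - xs‖ := by positivity
  have hsin := Real.sin_arcsin (by linarith) hle
  have hcos : ‖x - xs‖ * Real.cos (Real.arcsin (‖x‖ * Real.sin a / ‖x - xs‖)) =
      |‖xs‖ - ‖x‖ * Real.cos a| := by
    rw [← sq_eq_sq₀ (mul_nonneg hr.le (Real.cos_arcsin_nonneg _)) (abs_nonneg _), sq_abs, mul_pow,
      Real.cos_sq', hsin]
    field_simp
    linear_combination hsq
  unfold thetaStar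
  rw [← Real.cos_abs (angleFrom xs x), ← haa]
  split_ifs with h
  · rw [Real.sin_pi_sub, Real.cos_pi_sub, hsin, mul_div_cancel₀ _ hr.ne', mul_neg, hcos,
      abs_of_neg (by linarith)]
    simp
  · rw [hsin, mul_div_cancel₀ _ hr.ne', hcos, abs_of_nonneg (by linarith)]
    simp

theorem thetaStar_mem_Icc {x xs : Plane} : thetaStar x xs ∈ Set.Icc 0 Real.pi := by
  have hs : 0 ≤ Real.arcsin (‖x‖ * Real.sin |angleFrom xs x| / ‖x - xs‖) := by
    rw [Real.arcsin_nonneg]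
    have := Real.sin_nonneg_of_nonneg_of_le_pi (abs_nonneg _) (abs_angleFrom_le_pi xs x)
    positivity
  have hle := Real.arcsin_le_pi_div_two (‖x‖ * Real.sin |angleFrom xs x| / ‖x - xs‖)
  have hpi := Real.pi_pos
  unfold thetaStar
  split_ifs <;> constructor <;> linarith

theorem volume_real_regionA {x xs : Plane} (hne : x ≠ xs) (hxs : xs ≠ 0) :
    volume.real (regionA x xs) =
      ‖x - xs‖ ^ 2 * (|angleFrom xs x| + thetaStar x xs) - ‖xs‖ ^ 2 * |angleFrom xs x|
        + ‖x‖ * ‖xs‖ * Real.sin |angleFrom xs x| := by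
  have hr : 0 < ‖x - xs‖ := norm_pos_iff.mpr (sub_ne_zero.mpr hne)
  have hR : 0 < ‖xs‖ := norm_pos_iff.mpr hxs
  have hpi := Real.pi_pos
  obtain ⟨hsin, hcos⟩ := norm_mul_sin_thetaStar hne
  obtain ⟨hθ₀, hθ⟩ := thetaStar_mem_Icc (x := x) (xs := xs)
  obtain ⟨T, hx, -⟩ := exists_linearIsometryEquiv_polar x xs
  have hregion : regionA x xs = T ⁻¹' (Metric.ball (‖x‖ : ℂ) ‖x - xs‖ \ Metric.ball 0 ‖xs‖) := by
    rw [regionA, Set.preimage_sdiff, ← hx, ← map_zero T]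
    simp only [LinearIsometryEquiv.preimage_ball, LinearIsometryEquiv.symm_apply_apply]
  have hvol : volume.real (regionA x xs) =
      volume.real (Metric.ball (‖x‖ : ℂ) ‖x - xs‖ \ Metric.ball 0 ‖xs‖) := by
    rw [hregion, measureReal_def, T.measurePreserving.measure_preimage
      (measurableSet_ball.diff measurableSet_ball).nullMeasurableSet, measureReal_def]
  have ha₀ := abs_nonneg (angleFrom xs x)
  have ha := abs_angleFrom_le_pi xs x
  set a := |angleFrom xs x| with haa
  set θ := thetaStar x xs with hθθ
  have hsinγ : ‖x - xs‖ * Real.sin (Real.pi - a - θ) = ‖xs‖ * Real.sin a := by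
    rw [sub_sub, Real.sin_pi_sub, Real.sin_add]
    linear_combination Real.sin a * hcos + Real.cos a * hsin
  have hcosγ : ‖x - xs‖ * Real.cos (Real.pi - a - θ) = ‖x‖ - ‖xs‖ * Real.cos a := by
    rw [sub_sub, Real.cos_pi_sub, Real.cos_add]
    linear_combination -Real.cos a * hcos + Real.sin a * hsin
      + ‖x‖ * Real.sin_sq_add_cos_sq a
  -- The third angle, at `x`, has nonnegative sine by the law of sines, so it is not in `(-π, 0)`;
  -- the remaining case `a = θ = π` contradicts the cosine relation.
  have hγ : 0 ≤ Real.pi - a - θ := by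
    by_contra! hneg
    have hsa : 0 ≤ ‖x - xs‖ * Real.sin (Real.pi - a - θ) := by
      rw [hsinγ]
      exact mul_nonneg hR.le (Real.sin_nonneg_of_nonneg_of_le_pi ha₀ ha)
    by_cases hlt : -Real.pi < Real.pi - a - θ
    · have := Real.sin_neg_of_neg_of_neg_pi_lt hneg hlt
      nlinarith
    · have ha' : a = Real.pi := by linarith
      have hθ' : θ = Real.pi := by linarith
      rw [ha', hθ', Real.cos_pi] at hcos
      linarith [norm_nonneg x]
  rw [hvol, volume_real_ball_sdiff_ball hr.le hR.le (norm_nonneg x) ha₀ hγ (by linarith) hcosγ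
    hsinγ]
  ring

/-! ### Continuity of the area of the forbidden region -/

/-- Indicators converge pointwise off the two limiting circles, which are null, and all stay inside
one bounded set. -/
theorem tendsto_volume_ball_union_ball (x : Plane) (p : ℝ × ℝ) :
    Tendsto (fun q : ℝ × ℝ => volume (Metric.ball (0 : Plane) q.1 ∪ Metric.ball x q.2)) (𝓝 p)
      (𝓝 (volume (Metric.ball (0 : Plane) p.1 ∪ Metric.ball x p.2))) := by
  refine tendsto_measure_of_ae_tendsto_indicator (𝓝 p)
    (measurableSet_ball.union measurableSet_ball) (fun q => measurableSet_ball.union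
      measurableSet_ball) (B := Metric.ball 0 (p.1 + 1) ∪ Metric.ball x (p.2 + 1))
    (measurableSet_ball.union measurableSet_ball)
    (Metric.isBounded_ball.union Metric.isBounded_ball).measure_lt_top.ne ?_ ?_
  · have h1 : ∀ᶠ q : ℝ × ℝ in 𝓝 p, q.1 < p.1 + 1 :=
      continuous_fst.continuousAt.eventually_lt continuousAt_const (by linarith)
    have h2 : ∀ᶠ q : ℝ × ℝ in 𝓝 p, q.2 < p.2 + 1 :=
      continuous_snd.continuousAt.eventually_lt continuousAt_const (by linarith)
    filter_upwards [h1, h2] with q hq1 hq2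
    exact Set.union_subset_union (Metric.ball_subset_ball hq1.le) (Metric.ball_subset_ball hq2.le)
  · have h1 : ∀ᵐ z : Plane, z ∉ Metric.sphere (0 : Plane) p.1 :=
      measure_eq_zero_iff_ae_notMem.mp (Measure.addHaar_sphere _ _ _)
    have h2 : ∀ᵐ z : Plane, z ∉ Metric.sphere x p.2 :=
      measure_eq_zero_iff_ae_notMem.mp (Measure.addHaar_sphere _ _ _)
    have key : ∀ (d : ℝ) (φ : ℝ × ℝ → ℝ), Continuous φ → d ≠ φ p →
        ∀ᶠ q in 𝓝 p, (d < φ q ↔ d < φ p) := by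
      intro d φ hφ hd
      rcases lt_or_gt_of_ne hd with h | h
      · filter_upwards [continuousAt_const.eventually_lt hφ.continuousAt h] with q hq
        exact iff_of_true hq h
      · filter_upwards [hφ.continuousAt.eventually_lt continuousAt_const h] with q hq
        exact iff_of_false hq.not_gt h.not_gt
    filter_upwards [h1, h2] with z hz1 hz2
    filter_upwards [key (dist z 0) Prod.fst continuous_fst hz1,
      key (dist z x) Prod.snd continuous_snd hz2] with q hq1 hq2
    simp only [Set.mem_union, Metric.mem_ball, hq1, hq2]

theorem continuous_volume_ball_union_ball (x : Plane) :
    Continuous fun q : ℝ × ℝ => volume.real (Metric.ball (0 : Plane) q.1 ∪ Metric.ball x q.2) := by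
  rw [continuous_iff_continuousAt]
  intro p
  exact (ENNReal.tendsto_toReal
    (Metric.isBounded_ball.union Metric.isBounded_ball).measure_lt_top.ne).comp
      (tendsto_volume_ball_union_ball x p)

/-- The region that contains no other point when `y` is the point closest both to the origin and
to `x`. -/
def forbiddenRegion (x y : Plane) : Set Plane :=
  Metric.ball 0 ‖y‖ ∪ Metric.ball x ‖x - y‖

theorem continuous_volume_forbiddenRegion (x : Plane) :
    Continuous fun y => volume.real (forbiddenRegion x y) :=
  (continuous_volume_ball_union_ball x).comp
    (f := fun y : Plane => (‖y‖, ‖x - y‖)) (by fun_prop)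

theorem volume_forbiddenRegion_zero (y : Plane) :
    volume.real (forbiddenRegion 0 y) = Real.pi * ‖y‖ ^ 2 := by
  rw [forbiddenRegion, zero_sub, norm_neg, Set.union_self, volume_real_plane_ball _ (norm_nonneg y)]

/-- This difference is the exponent left when the density for `x` is divided by the density for `0`.
-/
theorem volume_regionA_eq_sub (x y : Plane) :
    volume.real (regionA x y) =
      volume.real (forbiddenRegion x y) - volume.real (forbiddenRegion 0 y) := by
  have h : regionA x y = forbiddenRegion x y \ forbiddenRegion 0 y := by
    simp only [regionA, forbiddenRegion, zero_sub, norm_neg, Set.union_self,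
      Set.union_sdiff_left]
  have hsub : forbiddenRegion 0 y ⊆ forbiddenRegion x y := by
    simp only [forbiddenRegion, zero_sub, norm_neg, Set.union_self]
    exact Set.subset_union_left
  rw [h, measureReal_sdiff hsub (measurableSet_ball.union measurableSet_ball)
    (Metric.isBounded_ball.union Metric.isBounded_ball).measure_lt_top.ne]

/-! ### Nearest points and Voronoi cells -/

/-- `c` is the unique point of `S` closest to `x`. -/
def IsNearest (S : Set Plane) (x c : Plane) : Prop :=
  c ∈ S ∧ ∀ z ∈ S, z ≠ c → ‖x - c‖ < ‖x - z‖

theorem IsNearest.unique {S : Set Plane} {x c d : Plane} (hc : IsNearest S x c)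
    (hd : IsNearest S x d) : c = d := by
  by_contra h
  exact lt_asymm (hc.2 d hd.1 (Ne.symm h)) (hd.2 c hc.1 h)

theorem isNearest_of_inter_ball_eq {S : Set Plane} {x c : Plane} {q : ℝ}
    (h : S ∩ Metric.ball x q = {c}) : IsNearest S x c := by
  have hc : c ∈ S ∩ Metric.ball x q := by rw [h]; rfl
  refine ⟨hc.1, fun z hz hzc => ?_⟩
  have hz' : z ∉ Metric.ball x q := fun hb => hzc (by
    have : z ∈ S ∩ Metric.ball x q := ⟨hz, hb⟩
    rwa [h] at this)
  rw [mem_ball_iff_norm', not_lt] at hz'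
  exact (mem_ball_iff_norm'.mp hc.2).trans_le hz'

/-- Local finiteness leaves a gap between the nearest and the next distance. A rational radius in it
expresses nearness by countably many counts. -/
theorem IsNearest.exists_rat_inter_ball_eq {S : Set Plane}
    (hS : ∀ B, Bornology.IsBounded B → (S ∩ B).Finite) {x c : Plane} (h : IsNearest S x c) :
    ∃ q : ℚ, S ∩ Metric.ball x q = {c} := by
  have hF : ((S ∩ Metric.closedBall x (‖x - c‖ + 1)) \ {c}).Finite :=
    (hS _ Metric.isBounded_closedBall).sdiff
  have h1 : ∀ᶠ d in 𝓝[>] ‖x - c‖,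
      ∀ z ∈ (S ∩ Metric.closedBall x (‖x - c‖ + 1)) \ {c}, d < ‖x - z‖ := by
    rw [eventually_all_finite hF]
    intro z hz
    exact (eventually_lt_nhds (h.2 z hz.1.1 hz.2)).filter_mono nhdsWithin_le_nhds
  have h2 : ∀ᶠ d in 𝓝[>] ‖x - c‖, d < ‖x - c‖ + 1 :=
    (eventually_lt_nhds (by linarith)).filter_mono nhdsWithin_le_nhds
  obtain ⟨d, ⟨hd1, hd2⟩, hd3⟩ := ((h1.and h2).and self_mem_nhdsWithin).exists
  obtain ⟨q, hq1, hq2⟩ := exists_rat_btwn hd3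
  refine ⟨q, Set.Subset.antisymm ?_ ?_⟩
  · rintro z ⟨hz, hzb⟩
    by_contra hzc
    rw [mem_ball_iff_norm'] at hzb
    have := hd1 z ⟨⟨hz, mem_closedBall_iff_norm'.mpr (by linarith)⟩, hzc⟩
    linarith
  · rintro z rfl
    exact ⟨h.1, mem_ball_iff_norm'.mpr hq1⟩

theorem IsNearest.nearestPoint_eq {S : Set Plane} {c : Plane} (h : IsNearest S 0 c) :
    nearestPoint S = c := by
  have hex : ∃ y ∈ S, ∀ z ∈ S, z ≠ y → ‖y‖ < ‖z‖ :=
    ⟨c, h.1, fun z hz hzc => by simpa using h.2 z hz hzc⟩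
  rw [nearestPoint, dif_pos hex]
  refine IsNearest.unique (S := S) (x := 0) ⟨hex.choose_spec.1, fun z hz hzc => ?_⟩ h
  simpa using hex.choose_spec.2 z hz hzc

theorem nearestPoint_eq_zero {S : Set Plane} (h : ¬ ∃ c, IsNearest S 0 c) :
    nearestPoint S = 0 := by
  rw [nearestPoint, dif_neg]
  rintro ⟨y, hy, hy'⟩
  exact h ⟨y, hy, fun z hz hzy => by simpa using hy' z hz hzy⟩

theorem IsNearest.mem_voronoiCell_iff {S : Set Plane} {x c : Plane} (h : IsNearest S 0 c) :
    x ∈ voronoiCell S (nearestPoint S) ↔ IsNearest S x c := by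
  rw [h.nearestPoint_eq]
  exact ⟨fun hx => ⟨h.1, fun z hz hzc => hx z ⟨hz, hzc⟩⟩, fun hx z hz => hx.2 z hz.1 hz.2⟩

/-- The event that some point of `Q` is both the point of `Φ` closest to the origin and the point
of `Φ` closest to `x`. -/
def commonNearestEvent {Ω : Type*} (Φ : Ω → Set Plane) (x : Plane) (Q : Set Plane) : Set Ω :=
  {ω | ∃ c ∈ Q, IsNearest (Φ ω) 0 c ∧ IsNearest (Φ ω) x c}

theorem commonNearestEvent_univ_inter_preimage {Ω : Type*} (Φ : Ω → Set Plane) (x : Plane)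
    (Q : Set Plane) :
    commonNearestEvent Φ x Set.univ ∩ (fun ω => nearestPoint (Φ ω)) ⁻¹' Q =
      commonNearestEvent Φ x Q := by
  ext ω
  constructor
  · rintro ⟨⟨c, -, h0, hx⟩, hQ⟩
    rw [Set.mem_preimage, h0.nearestPoint_eq] at hQ
    exact ⟨c, hQ, h0, hx⟩
  · rintro ⟨c, hQ, h0, hx⟩
    refine ⟨⟨c, trivial, h0, hx⟩, ?_⟩
    rwa [Set.mem_preimage, h0.nearestPoint_eq]

/-- Intersecting removes the realizations where `nearestPoint` takes its default value. -/
theorem cellEvent_inter_commonNearestEvent_zero {Ω : Type*} (Φ : Ω → Set Plane) (x : Plane) :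
    cellEvent Φ x ∩ commonNearestEvent Φ 0 Set.univ = commonNearestEvent Φ x Set.univ := by
  ext ω
  constructor
  · rintro ⟨hx, c, -, h0, -⟩
    exact ⟨c, trivial, h0, h0.mem_voronoiCell_iff.mp hx⟩
  · rintro ⟨c, -, h0, hx⟩
    exact ⟨h0.mem_voronoiCell_iff.mpr hx, c, trivial, h0, h0⟩

/-! ### Measurability and Poisson estimates -/

namespace IsHomogeneousPPP

variable {Ω : Type*} [MeasurableSpace Ω] {P : Measure Ω} {lam : ℝ} {Φ : Ω → Set Plane}

theorem measurableSet_count_eq (hΦ : IsHomogeneousPPP P lam Φ) {B : Set Plane}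
    (hB : MeasurableSet B) (hb : Bornology.IsBounded B) (k : ℕ) :
    MeasurableSet {ω | (Φ ω ∩ B).ncard = k} :=
  hΦ.measurable_count B hB hb (measurableSet_singleton k)

theorem measurableSet_commonNearestEvent (hΦ : IsHomogeneousPPP P lam Φ) (x : Plane)
    {Q : Set Plane} (hQ : MeasurableSet Q) : MeasurableSet (commonNearestEvent Φ x Q) := by
  -- The third count makes the two isolated points coincide and lie in `Q`.
  have h : commonNearestEvent Φ x Q = ⋃ q : ℚ, ⋃ q' : ℚ,
      {ω | (Φ ω ∩ Metric.ball 0 q).ncard = 1} ∩ ({ω | (Φ ω ∩ Metric.ball x q').ncard = 1} ∩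
        {ω | (Φ ω ∩ (Metric.ball 0 q ∩ (Metric.ball x q' ∩ Q))).ncard = 1}) := by
    ext ω
    simp only [Set.mem_iUnion, Set.mem_inter_iff, Set.mem_ofPred_eq, Set.ncard_eq_one]
    constructor
    · rintro ⟨c, hcQ, h0, hx⟩
      obtain ⟨q, hq⟩ := h0.exists_rat_inter_ball_eq (hΦ.locallyFinite ω)
      obtain ⟨q', hq'⟩ := hx.exists_rat_inter_ball_eq (hΦ.locallyFinite ω)
      refine ⟨q, q', ⟨c, hq⟩, ⟨c, hq'⟩, c, ?_⟩
      have hcx : c ∈ Φ ω ∩ Metric.ball x q' := by rw [hq']; rfl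
      rw [← Set.inter_assoc, hq, Set.inter_eq_left, Set.singleton_subset_iff]
      exact ⟨hcx.2, hcQ⟩
    · rintro ⟨q, q', ⟨a, ha⟩, ⟨b, hb⟩, ⟨c, hc⟩⟩
      obtain ⟨hcΦ, hc0, hcx, hcQ⟩ : c ∈ Φ ω ∩ (Metric.ball 0 (q : ℝ) ∩
        (Metric.ball x (q' : ℝ) ∩ Q)) := by rw [hc]; rfl
      have hca : c = a := by
        have : c ∈ Φ ω ∩ Metric.ball 0 (q : ℝ) := ⟨hcΦ, hc0⟩
        rwa [ha] at this
      have hcb : c = b := by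
        have : c ∈ Φ ω ∩ Metric.ball x (q' : ℝ) := ⟨hcΦ, hcx⟩
        rwa [hb] at this
      exact ⟨c, hcQ, isNearest_of_inter_ball_eq (hca ▸ ha), isNearest_of_inter_ball_eq (hcb ▸ hb)⟩
  rw [h]
  refine MeasurableSet.iUnion fun q => MeasurableSet.iUnion fun q' => ?_
  exact (hΦ.measurableSet_count_eq measurableSet_ball Metric.isBounded_ball 1).inter
    ((hΦ.measurableSet_count_eq measurableSet_ball Metric.isBounded_ball 1).inter
      (hΦ.measurableSet_count_eq (measurableSet_ball.inter (measurableSet_ball.inter hQ))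
        (Metric.isBounded_ball.subset Set.inter_subset_left) 1))

theorem measurable_nearestPoint (hΦ : IsHomogeneousPPP P lam Φ) :
    Measurable fun ω => nearestPoint (Φ ω) := by
  intro Q hQ
  have hU := hΦ.measurableSet_commonNearestEvent 0 MeasurableSet.univ
  have h : (fun ω => nearestPoint (Φ ω)) ⁻¹' Q =
      commonNearestEvent Φ 0 Q ∪ ((commonNearestEvent Φ 0 Set.univ)ᶜ ∩ {_ω | 0 ∈ Q}) := by
    rw [← commonNearestEvent_univ_inter_preimage]
    ext ω
    by_cases hω : ω ∈ commonNearestEvent Φ 0 Set.univ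
    · simp [hω]
    · have h0 : nearestPoint (Φ ω) = 0 :=
        nearestPoint_eq_zero fun ⟨c, hc⟩ => hω ⟨c, trivial, hc, hc⟩
      simp [hω, h0]
  rw [h]
  exact (hΦ.measurableSet_commonNearestEvent 0 hQ).union (hU.compl.inter (MeasurableSet.const _))

theorem measure_count_eq (hΦ : IsHomogeneousPPP P lam Φ) (hlam : 0 ≤ lam) {B : Set Plane}
    (hB : MeasurableSet B) (hb : Bornology.IsBounded B) (k : ℕ) :
    P {ω | (Φ ω ∩ B).ncard = k} = ENNReal.ofReal
      (Real.exp (-(lam * volume.real B)) * (lam * volume.real B) ^ k / k.factorial) := by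
  have h := hΦ.count_law B hB hb
  have h0 : 0 ≤ lam * volume.real B := by positivity
  have h1 : P {ω | (Φ ω ∩ B).ncard = k} = P.map (fun ω => (Φ ω ∩ B).ncard) {k} :=
    (Measure.map_apply (hΦ.measurable_count B hB hb) (measurableSet_singleton k)).symm
  rw [h1, h, poissonMeasure_singleton, Real.coe_toNNReal _ h0]

theorem measure_count_inter (hΦ : IsHomogeneousPPP P lam Φ) {B C : Set Plane}
    (hB : MeasurableSet B) (hBb : Bornology.IsBounded B) (hC : MeasurableSet C)
    (hCb : Bornology.IsBounded C) (hBC : Disjoint B C) (s t : Set ℕ) :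
    P ({ω | (Φ ω ∩ B).ncard ∈ s} ∩ {ω | (Φ ω ∩ C).ncard ∈ t}) =
      P {ω | (Φ ω ∩ B).ncard ∈ s} * P {ω | (Φ ω ∩ C).ncard ∈ t} := by
  have h := hΦ.count_indep 2 ![B, C] (by simp [Fin.forall_fin_two, hB, hC])
    (by simp [Fin.forall_fin_two, hBb, hCb]) (by simp [Fin.forall_fin_two, hBC, hBC.symm])
  have h01 := h.indepFun (i := 0) (j := 1) (by simp)
  exact h01.measure_inter_preimage_eq_mul s t (MeasurableSet.of_discrete)
    (MeasurableSet.of_discrete)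

/-- The event needs a point in `Q` and none in `G`. These sets are disjoint because `c` is never in
its own forbidden region, so the probabilities multiply; `1 - exp (-s) ≤ s` gives the factor `volume
Q`. -/
theorem measure_commonNearestEvent_le [IsProbabilityMeasure P] (hΦ : IsHomogeneousPPP P lam Φ)
    (hlam : 0 ≤ lam) {x : Plane} {Q G : Set Plane}
    (hQ : MeasurableSet Q) (hQb : Bornology.IsBounded Q)
    (hG : MeasurableSet G) (hGb : Bornology.IsBounded G)
    (h : ∀ c ∈ Q, G ⊆ forbiddenRegion x c) :
    P (commonNearestEvent Φ x Q) ≤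
      ENNReal.ofReal (lam * Real.exp (-lam * volume.real G)) * volume Q := by
  have hdisj : Disjoint Q G := by
    rw [Set.disjoint_left]
    intro c hcQ hcG
    rcases h c hcQ hcG with hc | hc
    · rw [mem_ball_zero_iff] at hc
      exact lt_irrefl _ hc
    · rw [mem_ball_iff_norm'] at hc
      exact lt_irrefl _ hc
  have hsub : commonNearestEvent Φ x Q ⊆
      {ω | (Φ ω ∩ Q).ncard ∈ ({0}ᶜ : Set ℕ)} ∩ {ω | (Φ ω ∩ G).ncard ∈ ({0} : Set ℕ)} := by
    rintro ω ⟨c, hcQ, h0, hx⟩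
    constructor
    · change (Φ ω ∩ Q).ncard ≠ 0
      rw [Ne, Set.ncard_eq_zero (hΦ.locallyFinite ω Q hQb)]
      exact Set.Nonempty.ne_empty ⟨c, h0.1, hcQ⟩
    · change (Φ ω ∩ G).ncard = 0
      rw [Set.ncard_eq_zero (hΦ.locallyFinite ω G hGb), Set.eq_empty_iff_forall_notMem]
      rintro z ⟨hz, hzG⟩
      have hzc : z ≠ c := by
        rintro rfl
        exact Set.disjoint_left.mp hdisj hcQ hzG
      rcases h c hcQ hzG with hb | hb
      · rw [mem_ball_zero_iff] at hb
        have := h0.2 z hz hzc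
        rw [zero_sub, zero_sub, norm_neg, norm_neg] at this
        exact lt_asymm hb this
      · rw [mem_ball_iff_norm'] at hb
        exact lt_asymm hb (hx.2 z hz hzc)
  have hQ0 := hΦ.measure_count_eq hlam hQ hQb 0
  have hG0 := hΦ.measure_count_eq hlam hG hGb 0
  have hcompl : P {ω | (Φ ω ∩ Q).ncard ∈ ({0}ᶜ : Set ℕ)} ≤
      ENNReal.ofReal (lam * volume.real Q) := by
    change P {ω | (Φ ω ∩ Q).ncard = 0}ᶜ ≤ _
    rw [prob_compl_eq_one_sub (hΦ.measurableSet_count_eq hQ hQb 0), hQ0, ← ENNReal.ofReal_one,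
      ← ENNReal.ofReal_sub _ (by positivity)]
    apply ENNReal.ofReal_le_ofReal
    have := Real.add_one_le_exp (-(lam * volume.real Q))
    simp only [pow_zero, Nat.factorial_zero, Nat.cast_one, mul_one, div_one]
    linarith
  calc P (commonNearestEvent Φ x Q) ≤ _ := measure_mono hsub
    _ = _ := hΦ.measure_count_inter hQ hQb hG hGb hdisj _ _
    _ ≤ ENNReal.ofReal (lam * volume.real Q) *
        ENNReal.ofReal (Real.exp (-(lam * volume.real G))) := by
      refine mul_le_mul' hcompl (le_of_eq ?_)
      rw [show {ω | (Φ ω ∩ G).ncard ∈ ({0} : Set ℕ)} = {ω | (Φ ω ∩ G).ncard = 0} from rfl, hG0]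
      simp
    _ = _ := by
      rw [ENNReal.ofReal_mul hlam, ENNReal.ofReal_mul hlam, ofReal_measureReal
        hQb.measure_lt_top.ne, neg_mul]
      ring

/-- One point in `Q` and none in `G \ Q` suffice; the two Poisson exponentials combine into that of
`G`. -/
theorem le_measure_commonNearestEvent (hΦ : IsHomogeneousPPP P lam Φ)
    (hlam : 0 ≤ lam) {x : Plane} {Q G : Set Plane}
    (hQ : MeasurableSet Q) (hG : MeasurableSet G) (hGb : Bornology.IsBounded G) (hQG : Q ⊆ G)
    (h : ∀ c ∈ Q, Metric.closedBall 0 ‖c‖ ∪ Metric.closedBall x ‖x - c‖ ⊆ G) :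
    ENNReal.ofReal (lam * Real.exp (-lam * volume.real G)) * volume Q ≤
      P (commonNearestEvent Φ x Q) := by
  have hQb : Bornology.IsBounded Q := hGb.subset hQG
  have hDb : Bornology.IsBounded (G \ Q) := hGb.subset Set.sdiff_subset
  have hsub : {ω | (Φ ω ∩ Q).ncard ∈ ({1} : Set ℕ)} ∩
      {ω | (Φ ω ∩ (G \ Q)).ncard ∈ ({0} : Set ℕ)} ⊆ commonNearestEvent Φ x Q := by
    rintro ω ⟨h1, h0⟩
    obtain ⟨c, hc⟩ := Set.ncard_eq_one.mp h1
    have h0' := (Set.ncard_eq_zero (hΦ.locallyFinite ω _ hDb)).mp h0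
    obtain ⟨hcΦ, hcQ⟩ : c ∈ Φ ω ∩ Q := by rw [hc]; rfl
    have hout : ∀ z ∈ Φ ω, z ≠ c → z ∉ G := by
      intro z hz hzc hzG
      by_cases hzQ : z ∈ Q
      · have : z ∈ Φ ω ∩ Q := ⟨hz, hzQ⟩
        rw [hc] at this
        exact hzc this
      · have : z ∈ Φ ω ∩ (G \ Q) := ⟨hz, hzG, hzQ⟩
        rw [h0'] at this
        exact this
    refine ⟨c, hcQ, ⟨hcΦ, fun z hz hzc => ?_⟩, hcΦ, fun z hz hzc => ?_⟩
    · by_contra! hle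
      rw [zero_sub, zero_sub, norm_neg, norm_neg] at hle
      exact hout z hz hzc (h c hcQ (Or.inl (mem_closedBall_zero_iff.mpr hle)))
    · by_contra! hle
      exact hout z hz hzc (h c hcQ (Or.inr (mem_closedBall_iff_norm'.mpr hle)))
  refine le_trans (le_of_eq ?_) (measure_mono hsub)
  rw [hΦ.measure_count_inter hQ hQb (hG.diff hQ) hDb Set.disjoint_sdiff_right]
  have hQ1 := hΦ.measure_count_eq hlam hQ hQb 1
  have hD0 := hΦ.measure_count_eq hlam (hG.diff hQ) hDb 0
  rw [show {ω | (Φ ω ∩ Q).ncard ∈ ({1} : Set ℕ)} = {ω | (Φ ω ∩ Q).ncard = 1} from rfl, hQ1,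
    show {ω | (Φ ω ∩ (G \ Q)).ncard ∈ ({0} : Set ℕ)} = {ω | (Φ ω ∩ (G \ Q)).ncard = 0} from rfl,
    hD0, ← ofReal_measureReal hQb.measure_lt_top.ne, ← ENNReal.ofReal_mul (by positivity),
    ← ENNReal.ofReal_mul (by positivity), measureReal_sdiff hQG hQ hGb.measure_lt_top.ne]
  congr 1
  have hexp : Real.exp (-lam * volume.real G) = Real.exp (-(lam * volume.real Q)) *
      Real.exp (-(lam * (volume.real G - volume.real Q))) := by
    rw [← Real.exp_add]
    congr 1
    ring
  rw [hexp]
  simp only [pow_zero, pow_one, Nat.factorial_zero, Nat.factorial_one, Nat.cast_one]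
  ring

end IsHomogeneousPPP

/-! ### Law of the nearest point -/

namespace IsHomogeneousPPP

variable {Ω : Type*} [MeasurableSpace Ω] {P : Measure Ω} {lam : ℝ} {Φ : Ω → Set Plane}

theorem map_nearestPoint_restrict_apply (hΦ : IsHomogeneousPPP P lam Φ) (x : Plane)
    {Q : Set Plane} (hQ : MeasurableSet Q) :
    (P.restrict (commonNearestEvent Φ x Set.univ)).map (fun ω => nearestPoint (Φ ω)) Q =
      P (commonNearestEvent Φ x Q) := by
  rw [Measure.map_apply hΦ.measurable_nearestPoint hQ,
    Measure.restrict_apply (hΦ.measurable_nearestPoint hQ), Set.inter_comm,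
    commonNearestEvent_univ_inter_preimage]

theorem tendsto_measure_commonNearestEvent_div [IsProbabilityMeasure P]
    (hΦ : IsHomogeneousPPP P lam Φ) (hlam : 0 ≤ lam) (x y : Plane) :
    Tendsto (fun r => P (commonNearestEvent Φ x (Metric.closedBall y r)) /
        volume (Metric.closedBall y r)) (𝓝[>] 0)
      (𝓝 (ENNReal.ofReal (lam * Real.exp (-lam * volume.real (forbiddenRegion x y))))) := by
  have hlim : ∀ k : ℝ, Tendsto (fun r : ℝ => ENNReal.ofReal (lam * Real.exp (-lam *
      volume.real (Metric.ball (0 : Plane) (‖y‖ + k * r) ∪ Metric.ball x (‖x - y‖ + k * r)))))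
      (𝓝[>] 0)
      (𝓝 (ENNReal.ofReal (lam * Real.exp (-lam * volume.real (forbiddenRegion x y))))) := by
    intro k
    have hcont : Continuous fun r : ℝ => ENNReal.ofReal (lam * Real.exp (-lam *
        volume.real (Metric.ball (0 : Plane) (‖y‖ + k * r) ∪
          Metric.ball x (‖x - y‖ + k * r)))) := by
      have := (continuous_volume_ball_union_ball x).comp
        (f := fun r : ℝ => (‖y‖ + k * r, ‖x - y‖ + k * r)) (by fun_prop)
      simp only [Function.comp_def] at this
      exact ENNReal.continuous_ofReal.comp (by fun_prop)
    have := hcont.tendsto 0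
    simp only [mul_zero, add_zero] at this
    exact this.mono_left nhdsWithin_le_nhds
  have hpos : ∀ r : ℝ, 0 < r → volume (Metric.closedBall y r) ≠ 0 := fun r hr =>
    (Metric.measure_closedBall_pos volume y hr).ne'
  have hfin : ∀ r : ℝ, volume (Metric.closedBall y r) ≠ ⊤ := fun r =>
    measure_closedBall_lt_top.ne
  have hnorm : ∀ (r : ℝ) (c : Plane), c ∈ Metric.closedBall y r →
      |‖c‖ - ‖y‖| ≤ r ∧ |‖x - c‖ - ‖x - y‖| ≤ r := by
    intro r c hc
    rw [mem_closedBall_iff_norm] at hc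
    refine ⟨(abs_norm_sub_norm_le c y).trans hc, (abs_norm_sub_norm_le _ _).trans ?_⟩
    rwa [sub_sub_sub_cancel_left, norm_sub_rev]
  -- Radii vary by at most `r`: shrinking by `r` fits inside every forbidden region, while `2 * r`
  -- leaves room to put closed balls inside open ones.
  refine tendsto_of_tendsto_of_tendsto_of_le_of_le' (hlim 2) (hlim (-1)) ?_ ?_
  · filter_upwards [self_mem_nhdsWithin] with r hr
    replace hr : 0 < r := hr
    rw [ENNReal.le_div_iff_mul_le (Or.inl (hpos r hr)) (Or.inl (hfin r))]
    refine hΦ.le_measure_commonNearestEvent hlam measurableSet_closedBall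
      (measurableSet_ball.union measurableSet_ball)
      (Metric.isBounded_ball.union Metric.isBounded_ball) ?_ ?_
    · intro c hc
      have := (abs_le.mp (hnorm r c hc).1).2
      exact Or.inl (mem_ball_zero_iff.mpr (by linarith))
    · intro c hc
      obtain ⟨h1, h2⟩ := hnorm r c hc
      rw [abs_le] at h1 h2
      exact Set.union_subset_union (Metric.closedBall_subset_ball (by linarith))
        (Metric.closedBall_subset_ball (by linarith))
  · filter_upwards [self_mem_nhdsWithin] with r hr
    rw [ENNReal.div_le_iff (hpos r hr) (hfin r)]
    refine hΦ.measure_commonNearestEvent_le hlam measurableSet_closedBall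
      Metric.isBounded_closedBall (measurableSet_ball.union measurableSet_ball)
      (Metric.isBounded_ball.union Metric.isBounded_ball) ?_
    intro c hc
    obtain ⟨h1, h2⟩ := hnorm r c hc
    rw [abs_le] at h1 h2
    exact Set.union_subset_union (Metric.ball_subset_ball (by linarith))
      (Metric.ball_subset_ball (by linarith))

theorem map_nearestPoint_restrict_absolutelyContinuous [IsProbabilityMeasure P]
    (hΦ : IsHomogeneousPPP P lam Φ) (hlam : 0 ≤ lam) (x : Plane) :
    (P.restrict (commonNearestEvent Φ x Set.univ)).map (fun ω => nearestPoint (Φ ω)) ≪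
      (volume : Measure Plane) := by
  refine Measure.AbsolutelyContinuous.mk fun B hB hB0 => ?_
  have hcover : B ⊆ ⋃ n : ℕ, B ∩ Metric.ball 0 n := by
    rw [← Set.inter_iUnion, Metric.iUnion_ball_nat, Set.inter_univ]
  refine measure_mono_null hcover (measure_iUnion_null fun n => ?_)
  rw [hΦ.map_nearestPoint_restrict_apply x (hB.inter measurableSet_ball), ← nonpos_iff_eq_zero]
  -- With `G = ∅` the upper bound is `lam * volume Q`.
  have hle := hΦ.measure_commonNearestEvent_le (x := x) hlam (hB.inter measurableSet_ball)
    (Metric.isBounded_ball.subset (Set.inter_subset_right (s := B) (t := Metric.ball 0 (n : ℝ))))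
    MeasurableSet.empty Bornology.isBounded_empty (fun _ _ => Set.empty_subset _)
  rwa [measure_mono_null Set.inter_subset_left hB0, mul_zero] at hle

/-- The joint law of the closest point and the event that it is also closest to `x`. -/
theorem map_nearestPoint_restrict_eq_withDensity [IsProbabilityMeasure P]
    (hΦ : IsHomogeneousPPP P lam Φ) (hlam : 0 ≤ lam) (x : Plane) :
    (P.restrict (commonNearestEvent Φ x Set.univ)).map (fun ω => nearestPoint (Φ ω)) =
      (volume : Measure Plane).withDensity fun y =>
        ENNReal.ofReal (lam * Real.exp (-lam * volume.real (forbiddenRegion x y))) := by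
  set ν := (P.restrict (commonNearestEvent Φ x Set.univ)).map (fun ω => nearestPoint (Φ ω))
    with hν
  have : IsFiniteMeasure ν := by rw [hν]; infer_instance
  rw [← Measure.withDensity_rnDeriv_eq ν volume
    (hΦ.map_nearestPoint_restrict_absolutelyContinuous hlam x)]
  refine withDensity_congr_ae ?_
  -- At almost every `y` the density is the limit of ratios over closed balls, which the Poisson
  -- estimates compute.
  filter_upwards [Besicovitch.ae_tendsto_rnDeriv ν (volume : Measure Plane)] with y hy
  refine tendsto_nhds_unique hy ?_
  simp only [hν, hΦ.map_nearestPoint_restrict_apply x measurableSet_closedBall]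
  exact hΦ.tendsto_measure_commonNearestEvent_div hlam x y

theorem measurable_exp_volume_forbiddenRegion (lam : ℝ) (x : Plane) : Measurable fun y =>
    ENNReal.ofReal (lam * Real.exp (-lam * volume.real (forbiddenRegion x y))) := by
  have := continuous_volume_forbiddenRegion x
  exact (ENNReal.continuous_ofReal.comp (by fun_prop)).measurable

theorem lintegral_density_nearestPoint (hlam : 0 < lam) :
    ∫⁻ y : Plane, ENNReal.ofReal (lam * Real.exp (-lam * volume.real (forbiddenRegion 0 y))) =
      1 := by
  have hpi := Real.pi_pos
  have hint : ∫ y : Plane, lam * Real.exp (-lam * volume.real (forbiddenRegion 0 y)) = 1 := by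
    have h := GaussianFourier.integral_rexp_neg_mul_sq_norm (V := Plane)
      (b := lam * Real.pi) (by positivity)
    simp_rw [volume_forbiddenRegion_zero, ← mul_assoc, neg_mul]
    simp_rw [neg_mul] at h
    rw [integral_const_mul, h, finrank_euclideanSpace_fin]
    norm_num
    field_simp
  rw [← ofReal_integral_eq_lintegral_ofReal, hint, ENNReal.ofReal_one]
  · exact Integrable.of_integral_ne_zero (by rw [hint]; exact one_ne_zero)
  · exact Eventually.of_forall fun y => by positivity

/-- Almost sure existence and uniqueness of the nearest point is read off from the total mass of its
density. -/
theorem measure_commonNearestEvent_zero_univ [IsProbabilityMeasure P]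
    (hΦ : IsHomogeneousPPP P lam Φ) (hlam : 0 < lam) :
    P (commonNearestEvent Φ 0 Set.univ) = 1 := by
  rw [← hΦ.map_nearestPoint_restrict_apply 0 MeasurableSet.univ,
    hΦ.map_nearestPoint_restrict_eq_withDensity hlam.le, withDensity_apply _ MeasurableSet.univ,
    setLIntegral_univ, lintegral_density_nearestPoint hlam]

theorem ae_mem_commonNearestEvent_zero [IsProbabilityMeasure P]
    (hΦ : IsHomogeneousPPP P lam Φ) (hlam : 0 < lam) :
    ∀ᵐ ω ∂P, ω ∈ commonNearestEvent Φ 0 Set.univ :=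
  (mem_ae_iff_prob_eq_one (hΦ.measurableSet_commonNearestEvent 0 MeasurableSet.univ)).mpr
    (hΦ.measure_commonNearestEvent_zero_univ hlam)

theorem map_nearestPoint_eq_withDensity [IsProbabilityMeasure P]
    (hΦ : IsHomogeneousPPP P lam Φ) (hlam : 0 < lam) :
    P.map (fun ω => nearestPoint (Φ ω)) = (volume : Measure Plane).withDensity fun y =>
        ENNReal.ofReal (lam * Real.exp (-lam * volume.real (forbiddenRegion 0 y))) := by
  rw [← hΦ.map_nearestPoint_restrict_eq_withDensity hlam.le,
    Measure.restrict_eq_self_of_ae_mem (hΦ.ae_mem_commonNearestEvent_zero hlam)]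

theorem cellEvent_ae_eq [IsProbabilityMeasure P] (hΦ : IsHomogeneousPPP P lam Φ)
    (hlam : 0 < lam) (x : Plane) :
    cellEvent Φ x =ᵐ[P] commonNearestEvent Φ x Set.univ := by
  rw [← cellEvent_inter_commonNearestEvent_zero]
  exact (inter_ae_eq_left_of_ae_eq_univ
    (eventuallyEq_univ.mpr (hΦ.ae_mem_commonNearestEvent_zero hlam))).symm

end IsHomogeneousPPP

/-! ### Conditional probabilities -/

theorem continuous_exp_volume_regionA (lam : ℝ) (x : Plane) :
    Continuous fun y => Real.exp (-lam * volume.real (regionA x y)) := by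
  have h1 := continuous_volume_forbiddenRegion x
  have h0 := continuous_volume_forbiddenRegion 0
  simp_rw [volume_regionA_eq_sub]
  fun_prop

theorem exp_volume_regionA_le_one {lam : ℝ} (hlam : 0 ≤ lam) (x y : Plane) :
    Real.exp (-lam * volume.real (regionA x y)) ≤ 1 := by
  rw [Real.exp_le_one_iff, neg_mul, neg_nonpos]
  positivity

namespace IsHomogeneousPPP

variable {Ω : Type*} [MeasurableSpace Ω] {P : Measure Ω} {lam : ℝ} {Φ : Ω → Set Plane}

theorem integrable_exp_volume_regionA (hlam : 0 ≤ lam) (x : Plane) (μ : Measure Plane)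
    [IsFiniteMeasure μ] : Integrable (fun y => Real.exp (-lam * volume.real (regionA x y))) μ :=
  Integrable.of_bound (continuous_exp_volume_regionA lam x).aestronglyMeasurable 1
    (Eventually.of_forall fun y => by
      rw [Real.norm_of_nonneg (Real.exp_nonneg _)]
      exact exp_volume_regionA_le_one hlam x y)

theorem measureReal_commonNearestEvent [IsProbabilityMeasure P]
    (hΦ : IsHomogeneousPPP P lam Φ) (hlam : 0 < lam) (x : Plane) {Q : Set Plane}
    (hQ : MeasurableSet Q) :
    P.real (commonNearestEvent Φ x Q) = ∫ y in Q, Real.exp (-lam * volume.real (regionA x y))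
      ∂(P.map fun ω => nearestPoint (Φ ω)) := by
  have : IsProbabilityMeasure (P.map fun ω => nearestPoint (Φ ω)) :=
    Measure.isProbabilityMeasure_map hΦ.measurable_nearestPoint.aemeasurable
  have hprod : (fun y => ENNReal.ofReal (lam * Real.exp (-lam * volume.real (forbiddenRegion x y))))
      = (fun y => ENNReal.ofReal (lam * Real.exp (-lam * volume.real (forbiddenRegion 0 y)))) *
        fun y => ENNReal.ofReal (Real.exp (-lam * volume.real (regionA x y))) := by
    ext y
    rw [Pi.mul_apply, ← ENNReal.ofReal_mul (by positivity), mul_assoc, ← Real.exp_add,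
      volume_regionA_eq_sub]
    ring_nf
  have hg : Measurable fun y => ENNReal.ofReal (Real.exp (-lam * volume.real (regionA x y))) :=
    (continuous_exp_volume_regionA lam x).measurable.ennreal_ofReal
  rw [measureReal_def, ← hΦ.map_nearestPoint_restrict_apply x hQ,
    hΦ.map_nearestPoint_restrict_eq_withDensity hlam.le, hprod,
    withDensity_mul _ (measurable_exp_volume_forbiddenRegion lam 0) hg, ← hΦ.map_nearestPoint_eq_withDensity hlam,
    withDensity_apply _ hQ, integral_eq_lintegral_of_nonneg_ae
      (Eventually.of_forall fun y => Real.exp_nonneg _)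
      (continuous_exp_volume_regionA lam x).aestronglyMeasurable]

theorem measure_nearestPoint_mem_ball_ne_zero [IsProbabilityMeasure P]
    (hΦ : IsHomogeneousPPP P lam Φ) (hlam : 0 < lam) (y : Plane) {ε : ℝ} (hε : 0 < ε) :
    P.map (fun ω => nearestPoint (Φ ω)) (Metric.ball y ε) ≠ 0 := by
  rw [hΦ.map_nearestPoint_eq_withDensity hlam, Ne, withDensity_apply_eq_zero
    (measurable_exp_volume_forbiddenRegion lam 0)]
  have huniv : {z : Plane | ENNReal.ofReal
      (lam * Real.exp (-lam * volume.real (forbiddenRegion 0 z))) ≠ 0} = Set.univ := by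
    rw [Set.eq_univ_iff_forall]
    intro z
    exact (ENNReal.ofReal_pos.mpr (by positivity)).ne'
  rw [huniv, Set.univ_inter]
  exact (Metric.measure_ball_pos volume y hε).ne'

theorem cellProbNear_eq_setAverage [IsProbabilityMeasure P]
    (hΦ : IsHomogeneousPPP P lam Φ) (hlam : 0 < lam) (x xs : Plane) (ε : ℝ) :
    cellProbNear P Φ x xs ε = ⨍ y in Metric.ball xs ε,
      Real.exp (-lam * volume.real (regionA x y)) ∂(P.map fun ω => nearestPoint (Φ ω)) := by
  have hball : MeasurableSet (Metric.ball xs ε) := measurableSet_ball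
  have hS : MeasurableSet {ω | nearestPoint (Φ ω) ∈ Metric.ball xs ε} :=
    hΦ.measurable_nearestPoint hball
  have hE : P.real ({ω | nearestPoint (Φ ω) ∈ Metric.ball xs ε} ∩ cellEvent Φ x) =
      P.real (commonNearestEvent Φ x (Metric.ball xs ε)) := by
    rw [← commonNearestEvent_univ_inter_preimage, Set.inter_comm]
    exact measureReal_congr ((hΦ.cellEvent_ae_eq hlam x).inter (ae_eq_refl _))
  rw [cellProbNear, measureReal_def, cond_apply hS, ENNReal.toReal_mul, ENNReal.toReal_inv,
    ← measureReal_def, ← measureReal_def, hE, hΦ.measureReal_commonNearestEvent hlam x hball,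
    setAverage_eq, smul_eq_mul, map_measureReal_apply hΦ.measurable_nearestPoint hball]
  rfl

/-- Near `xs` the continuous integrand stays in a small closed interval, which is convex and so
contains its averages. -/
theorem tendsto_cellProbNear [IsProbabilityMeasure P]
    (hΦ : IsHomogeneousPPP P lam Φ) (hlam : 0 < lam) (x xs : Plane) :
    Tendsto (cellProbNear P Φ x xs) (𝓝[>] 0)
      (𝓝 (Real.exp (-lam * volume.real (regionA x xs)))) := by
  have : IsProbabilityMeasure (P.map fun ω => nearestPoint (Φ ω)) :=
    Measure.isProbabilityMeasure_map hΦ.measurable_nearestPoint.aemeasurable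
  rw [Metric.nhds_basis_closedBall.tendsto_right_iff]
  intro η hη
  have hnear : ∀ᶠ y in 𝓝 xs, Real.exp (-lam * volume.real (regionA x y)) ∈
      Metric.closedBall (Real.exp (-lam * volume.real (regionA x xs))) η :=
    (continuous_exp_volume_regionA lam x).continuousAt (Metric.closedBall_mem_nhds _ hη)
  obtain ⟨δ, hδ, hsub⟩ := Metric.eventually_nhds_iff_ball.mp hnear
  filter_upwards [Ioo_mem_nhdsGT hδ] with ε hε
  rw [hΦ.cellProbNear_eq_setAverage hlam]
  refine (convex_closedBall _ _).set_average_mem Metric.isClosed_closedBall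
    (hΦ.measure_nearestPoint_mem_ball_ne_zero hlam xs hε.1) (measure_ne_top _ _) ?_
    (integrable_exp_volume_regionA hlam.le x _).integrableOn
  filter_upwards [ae_restrict_mem measurableSet_ball] with y hy
  exact hsub y (Metric.ball_subset_ball hε.2.le hy)

theorem pca_eq [IsProbabilityMeasure P] (hΦ : IsHomogeneousPPP P lam Φ) (hlam : 0 < lam)
    (x xs : Plane) : pca P Φ x xs = Real.exp (-lam * volume.real (regionA x xs)) :=
  (hΦ.tendsto_cellProbNear hlam x xs).limUnder_eq

theorem condExp_cellEvent_ae_eq [IsProbabilityMeasure P] (hΦ : IsHomogeneousPPP P lam Φ)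
    (hlam : 0 < lam) (x : Plane) :
    P⟦cellEvent Φ x|MeasurableSpace.comap (fun ω => nearestPoint (Φ ω)) inferInstance⟧
      =ᵐ[P] fun ω => Real.exp (-lam * volume.real (regionA x (nearestPoint (Φ ω)))) := by
  have : IsProbabilityMeasure (P.map fun ω => nearestPoint (Φ ω)) :=
    Measure.isProbabilityMeasure_map hΦ.measurable_nearestPoint.aemeasurable
  have hc := hΦ.measurable_nearestPoint
  have hW := hΦ.measurableSet_commonNearestEvent x MeasurableSet.univ
  have hg := continuous_exp_volume_regionA lam x
  have hgint : Integrable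
      (fun ω => Real.exp (-lam * volume.real (regionA x (nearestPoint (Φ ω))))) P :=
    (integrable_exp_volume_regionA hlam.le x _).comp_measurable hc
  have hind : (cellEvent Φ x).indicator (fun _ => (1 : ℝ)) =ᵐ[P]
      (commonNearestEvent Φ x Set.univ).indicator fun _ => (1 : ℝ) :=
    indicator_ae_eq_of_ae_eq_set (hΦ.cellEvent_ae_eq hlam x)
  -- `cellEvent` is known to be measurable only up to a null set, so a measurable event replaces it.
  refine (condExp_congr_ae hind).trans (EventuallyEq.symm ?_)
  refine ae_eq_condExp_of_forall_setIntegral_eq hc.comap_le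
    ((integrable_const 1).indicator hW) (fun _ _ _ => hgint.integrableOn) ?_ ?_
  · rintro s ⟨B, hB, rfl⟩ -
    rw [integral_indicator hW, setIntegral_const, smul_eq_mul, mul_one,
      measureReal_restrict_apply hW, commonNearestEvent_univ_inter_preimage,
      hΦ.measureReal_commonNearestEvent hlam x hB,
      setIntegral_map hB hg.aestronglyMeasurable hc.aemeasurable]
  · exact (hg.measurable.comp (comap_measurable _)).aestronglyMeasurable

end IsHomogeneousPPP

theorem lemma2 {Ω : Type*} [MeasurableSpace Ω] (P : Measure Ω) [IsProbabilityMeasure P]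
    (lam : ℝ) (hlam : 0 < lam) (Φ : Ω → Set Plane) (hΦ : IsHomogeneousPPP P lam Φ) :
    -- `p_c (x | xs)` exists as a limit at every single `xs` ...
    (∀ x xs : Plane, Tendsto (cellProbNear P Φ x xs) (𝓝[>] 0) (𝓝 (pca P Φ x xs))) ∧
    -- ... and is a version of the conditional probability given the closest point
    (Measurable fun ω => nearestPoint (Φ ω)) ∧
    (∀ x : Plane, NullMeasurableSet (cellEvent Φ x) P ∧
      P⟦cellEvent Φ x|MeasurableSpace.comap (fun ω => nearestPoint (Φ ω)) inferInstance⟧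
        =ᵐ[P] fun ω => pca P Φ x (nearestPoint (Φ ω))) ∧
    -- the value of `p_c`
    (∀ x xs : Plane, ‖x‖ ≤ ‖xs‖ → angleFrom xs x = 0 → pca P Φ x xs = 1) ∧
    (∀ x xs : Plane, ¬ (‖x‖ ≤ ‖xs‖ ∧ angleFrom xs x = 0) →
      pca P Φ x xs = Real.exp (-lam * volume.real (regionA x xs)) ∧
      Real.exp (-lam * volume.real (regionA x xs)) < 1) ∧
    -- the area of the region
    (∀ x xs : Plane, x ≠ xs → xs ≠ 0 →
      volume.real (regionA x xs) =
        ‖x - xs‖ ^ 2 * (|angleFrom xs x| + thetaStar x xs) - ‖xs‖ ^ 2 * |angleFrom xs x|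
          + ‖x‖ * ‖xs‖ * Real.sin |angleFrom xs x|) ∧
    (∀ x xs : Plane, x ≠ xs → xs = 0 → volume.real (regionA x xs) = Real.pi * ‖x‖ ^ 2) ∧
    (∀ x xs : Plane, ‖x - xs‖ =
      Real.sqrt (‖x‖ ^ 2 + ‖xs‖ ^ 2 - 2 * ‖x‖ * ‖xs‖ * Real.cos (angleFrom xs x))) := by

  refine ⟨fun x xs => ?_, hΦ.measurable_nearestPoint, fun x => ⟨?_, ?_⟩, fun x xs hle ha => ?_,
    fun x xs h => ⟨hΦ.pca_eq hlam x xs, ?_⟩, fun x xs => volume_real_regionA, ?_,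
    norm_sub_eq_sqrt_of_angleFrom⟩
  · rw [hΦ.pca_eq hlam]
    exact hΦ.tendsto_cellProbNear hlam x xs
  · exact (hΦ.measurableSet_commonNearestEvent x MeasurableSet.univ).nullMeasurableSet.congr
      (hΦ.cellEvent_ae_eq hlam x).symm
  · simp_rw [hΦ.pca_eq hlam]
    exact hΦ.condExp_cellEvent_ae_eq hlam x
  · rw [hΦ.pca_eq hlam, regionA_eq_empty hle ha, measureReal_empty, mul_zero, Real.exp_zero]
  · rw [Real.exp_lt_one_iff, neg_mul, neg_lt_zero]
    exact mul_pos hlam (volume_regionA_pos h)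
  · rintro x xs - rfl
    exact volume_real_regionA_zero x
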